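/- Let $(X,d)$ be a complete $CAT(0)$ space, that is, a complete metric space in which any two distinct points are joined by a geodesic and in which, for every geodesic triangle and any two points on its sides, the distance between these points is at most the distance between the corresponding comparison points in a Euclidean comparison triangle. Let $K\subset X$ be nonempty, closed, bounded and convex (every geodesic segment joining two points of $K$ lies in $K$), and let $T:K\to K$ be nonexpansive, i.e. $d(Tx,Ty)\le d(x,y)$ for all $x,y\in K$. For $t\in[0,1]$ and $x,y\in X$ let $(1-t)x\oplus ty$ denote the point $z$ of the geodesic segment $[x,y]$ with $d(z,x)=t\,d(x,y)$ and $d(z,y)=(1-t)\,d(x,y)$. Let $(\lambda_n)_{n\ge1}\subset(0,1)$, let $x_0\in K$, and define $$x_{n}=(1-\lambda_{n})\,x_{n-1}\oplus\lambda_{n}\,Tx_{n-1},\qquad n\ge1.$$ Then $$d(x_n,Tx_n)\;\le\;\frac{\operatorname{diam}(K)}{\sqrt{\pi\,\sum_{i=1}^{n}\lambda_i(1-\lambda_i)}}\qquad\text{for all } n\ge1.$$ -/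

import Mathlib

/-- `γ` restricted to `[0, l]` is a geodesic path joining `x` to `y`. -/
def IsGeodesicPath {X : Type*} [MetricSpace X] (γ : ℝ → X) (l : ℝ) (x y : X) : Prop :=
  0 ≤ l ∧ γ 0 = x ∧ γ l = y ∧
    ∀ s ∈ Set.Icc (0 : ℝ) l, ∀ t ∈ Set.Icc (0 : ℝ) l, dist (γ s) (γ t) = |s - t|

/-- `S` is a geodesic segment with endpoints `x` and `y`: the image of a geodesic path. -/
def IsGeodesicSegment {X : Type*} [MetricSpace X] (S : Set X) (x y : X) : Prop :=
  ∃ (γ : ℝ → X) (l : ℝ), IsGeodesicPath γ l x y ∧ S = γ '' Set.Icc (0 : ℝ) l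

/-- Every two distinct points are joined by a geodesic path. -/
def IsGeodesicSpace (X : Type*) [MetricSpace X] : Prop :=
  ∀ x y : X, x ≠ y → ∃ (γ : ℝ → X) (l : ℝ), IsGeodesicPath γ l x y

/-- A geodesic triangle: three distinct vertices and, for each pair of them, a choice of a geodesic
segment joining them. Indices are cyclic modulo 3: `side i` joins `vertex i` to `vertex (i + 1)`. -/
structure GeodesicTriangle (X : Type*) [MetricSpace X] where
  vertex : Fin 3 → X
  vertex_injective : Function.Injective vertex
  side : Fin 3 → Set X
  isGeodesicSegment_side : ∀ i, IsGeodesicSegment (side i) (vertex i) (vertex (i + 1))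

/-- `v` are the vertices of a comparison triangle of `Δ` in the Euclidean plane. -/
def GeodesicTriangle.IsComparisonTriangle {X : Type*} [MetricSpace X] (Δ : GeodesicTriangle X)
    (v : Fin 3 → EuclideanSpace ℝ (Fin 2)) : Prop :=
  ∀ i j, dist (v i) (v j) = dist (Δ.vertex i) (Δ.vertex j)

/-- `x` lies on the `i`-th side of `Δ`, and `x'` is the comparison point of `x` on the
corresponding side of the Euclidean triangle with vertices `v`. -/
def GeodesicTriangle.IsComparisonPoint {X : Type*} [MetricSpace X] (Δ : GeodesicTriangle X)
    (v : Fin 3 → EuclideanSpace ℝ (Fin 2)) (i : Fin 3) (x : X)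
    (x' : EuclideanSpace ℝ (Fin 2)) : Prop :=
  x ∈ Δ.side i ∧ x' ∈ segment ℝ (v i) (v (i + 1)) ∧
    dist x' (v i) = dist x (Δ.vertex i) ∧ dist x' (v (i + 1)) = dist x (Δ.vertex (i + 1))

/-- The CAT(0) inequality for `Δ`: distances between points of `Δ` do not exceed the distances
between their comparison points. -/
def GeodesicTriangle.SatisfiesCAT0 {X : Type*} [MetricSpace X] (Δ : GeodesicTriangle X) : Prop :=
  ∀ v : Fin 3 → EuclideanSpace ℝ (Fin 2), Δ.IsComparisonTriangle v →
    ∀ (i j : Fin 3) (x y : X) (x' y' : EuclideanSpace ℝ (Fin 2)),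
      Δ.IsComparisonPoint v i x x' → Δ.IsComparisonPoint v j y y' → dist x y ≤ dist x' y'

/-- CAT(0) spaces: geodesic spaces all of whose geodesic triangles satisfy the CAT(0)
inequality. -/
def IsCAT0Space (X : Type*) [MetricSpace X] : Prop :=
  IsGeodesicSpace X ∧ ∀ Δ : GeodesicTriangle X, Δ.SatisfiesCAT0

/-- `C` contains every geodesic segment joining two of its points. -/
def IsGeodesicallyConvex {X : Type*} [MetricSpace X] (C : Set X) : Prop :=
  ∀ x ∈ C, ∀ y ∈ C, ∀ S : Set X, IsGeodesicSegment S x y → S ⊆ C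

/-- `z = (1 - t) x ⊕ t y`: the point `z` lies on a geodesic segment with endpoints `x` and `y`,
`d(z, x) = t d(x, y)` and `d(z, y) = (1 - t) d(x, y)`. In a CAT(0) space there is exactly one such
point for each `t ∈ [0, 1]`. -/
def IsGeodesicCombination {X : Type*} [MetricSpace X] (t : ℝ) (x y z : X) : Prop :=
  (∃ S : Set X, IsGeodesicSegment S x y ∧ z ∈ S) ∧
    dist z x = t * dist x y ∧ dist z y = (1 - t) * dist x y

/-- `x` is a sequence of Krasnosel'skii-Mann iterates of `T` with starting point in `K` and step
sizes `lam 1, lam 2, …`: `x (n + 1) = (1 - lam (n + 1)) x n ⊕ lam (n + 1) T (x n)`. -/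
def IsKMIteration {X : Type*} [MetricSpace X] (K : Set X) (T : X → X) (lam : ℕ → ℝ)
    (x : ℕ → X) : Prop :=
  x 0 ∈ K ∧ ∀ n : ℕ, IsGeodesicCombination (lam (n + 1)) (x n) (T (x n)) (x (n + 1))

/-! ### Convexity of the distance to a point in a CAT(0) space -/

/-! Convexity of the distance to a point, together with nonexpansiveness, gives recursive
inequalities for `d(x m, x n)` and `d(x m, T (x n))`, `m ≤ n`. Solved with equality
(`le_leadExpectation`), they have a probabilistic form: if `N`, `N'` count successes in independent
Bernoulli trials with parameters `lam 1, …, lam n` and `lam 1, …, lam m`, the distances are at most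
`diam K` times `E sign (N - N')` and `E sign (1 + N - N')`. For `m = n`, `S = N - N'` is a lazy
symmetric walk, so the second factor is `P(S = 0) + P(S = 1)`. Fourier inversion and a Gaussian
bound (`walkSign_one_le`) give the constant `1 / √π`. -/

theorem exists_euclidean_triangle {a b c : ℝ} (ha : 0 < a) (hb : 0 ≤ b) (hc : 0 ≤ c)
    (hab : a ≤ b + c) (hbc : b ≤ a + c) (hca : c ≤ a + b) :
    ∃ u v w : EuclideanSpace ℝ (Fin 2), dist u v = a ∧ dist v w = c ∧ dist w u = b := by
  -- Abscissa of the third vertex, from the law of cosines.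
  set s : ℝ := (a ^ 2 + b ^ 2 - c ^ 2) / (2 * a) with hs
  have hsa : 2 * a * s = a ^ 2 + b ^ 2 - c ^ 2 := by rw [hs]; field_simp
  have h₁ : s ≤ b := by
    rw [hs, div_le_iff₀ (by positivity)]
    nlinarith [mul_nonneg (sub_nonneg.2 hbc) (by linarith : 0 ≤ c + b - a),
      mul_nonneg (sub_nonneg.2 hab) (by linarith : 0 ≤ a + c - b)]
  have h₂ : -b ≤ s := by
    rw [hs, le_div_iff₀ (by positivity)]
    nlinarith [mul_nonneg (sub_nonneg.2 hca) (by linarith : 0 ≤ a + b + c)]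
  have h₃ : 0 ≤ b ^ 2 - s ^ 2 := by nlinarith
  have hsq : √(b ^ 2 - s ^ 2) ^ 2 = b ^ 2 - s ^ 2 := Real.sq_sqrt h₃
  refine ⟨!₂[0, 0], !₂[a, 0], !₂[s, √(b ^ 2 - s ^ 2)], ?_, ?_, ?_⟩
  · rw [EuclideanSpace.dist_eq, Real.sqrt_eq_iff_eq_sq (by positivity) ha.le]
    simp [Real.dist_eq]
  · rw [EuclideanSpace.dist_eq, Real.sqrt_eq_iff_eq_sq (by positivity) hc]
    simp only [Real.dist_eq, sq_abs, Fin.sum_univ_two]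
    simp
    nlinarith
  · rw [EuclideanSpace.dist_eq, Real.sqrt_eq_iff_eq_sq (by positivity) hb]
    simp only [Real.dist_eq, sq_abs, Fin.sum_univ_two]
    simp
    nlinarith

theorem IsGeodesicSegment.left_mem {X : Type*} [MetricSpace X] {S : Set X} {x y : X}
    (h : IsGeodesicSegment S x y) : x ∈ S := by
  obtain ⟨γ, l, ⟨hl, h0, -, -⟩, rfl⟩ := h
  exact ⟨0, ⟨le_rfl, hl⟩, h0⟩

theorem IsGeodesicSpace.exists_segment {X : Type*} [MetricSpace X] (hX : IsGeodesicSpace X)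
    {x y : X} (hxy : x ≠ y) : ∃ S : Set X, IsGeodesicSegment S x y := by
  obtain ⟨γ, l, h⟩ := hX x y hxy
  exact ⟨_, γ, l, h, rfl⟩

/-- Comparing with a Euclidean triangle reduces this to convexity of the norm; degenerate triangles
are treated separately because vertices must be distinct. -/
theorem IsCAT0Space.dist_geodesicCombination_le {X : Type*} [MetricSpace X] (hX : IsCAT0Space X)
    {t : ℝ} (ht : t ∈ Set.Icc (0 : ℝ) 1) {x y z : X} (hz : IsGeodesicCombination t x y z) (p : X) :
    dist z p ≤ (1 - t) * dist x p + t * dist y p := by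
  obtain ⟨⟨S, hS, hzS⟩, hzx, hzy⟩ := hz
  obtain ⟨ht0, ht1⟩ := ht
  rcases eq_or_ne x y with rfl | hxy
  · rw [dist_self, mul_zero, dist_eq_zero] at hzx
    rw [hzx]; linarith
  rcases eq_or_ne y p with rfl | hyp
  · rw [hzy, dist_self]; linarith
  rcases eq_or_ne p x with rfl | hpx
  · rw [hzx, dist_self, dist_comm y]; linarith
  obtain ⟨S₁, hS₁⟩ := hX.1.exists_segment hyp
  obtain ⟨S₂, hS₂⟩ := hX.1.exists_segment hpx
  let Δ : GeodesicTriangle X :=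
    { vertex := ![x, y, p]
      vertex_injective := by
        intro i j hij
        fin_cases i <;> fin_cases j <;> simp_all [eq_comm]
      side := ![S, S₁, S₂]
      isGeodesicSegment_side := by
        intro i
        fin_cases i
        · exact hS
        · exact hS₁
        · exact hS₂ }
  obtain ⟨u, v, w, huv, hvw, hwu⟩ := exists_euclidean_triangle (dist_pos.2 hxy)
    (dist_nonneg (x := p) (y := x)) (dist_nonneg (x := y) (y := p))
    (by linarith [dist_triangle x p y, dist_comm x p, dist_comm y p])
    (by linarith [dist_triangle p y x, dist_comm x y, dist_comm y p])
    (by linarith [dist_triangle y x p, dist_comm x y, dist_comm x p])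
  have hcomp : Δ.IsComparisonTriangle ![u, v, w] := by
    intro i j
    fin_cases i <;> fin_cases j <;> simp [Δ, huv, hvw, hwu, dist_comm v u, dist_comm w v,
      dist_comm u w, dist_comm y x, dist_comm p y, dist_comm x p]
  set z' : EuclideanSpace ℝ (Fin 2) := AffineMap.lineMap u v t with hz'
  have hzcomp : Δ.IsComparisonPoint ![u, v, w] 0 z z' := by
    refine ⟨hzS, ?_, ?_, ?_⟩
    · rw [segment_eq_image_lineMap]
      exact ⟨t, ⟨ht0, ht1⟩, rfl⟩
    · change dist z' u = dist z x
      rw [hz', dist_lineMap_left, Real.norm_of_nonneg ht0, huv, hzx]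
    · change dist z' v = dist z y
      rw [hz', dist_lineMap_right, Real.norm_of_nonneg (by linarith), huv, hzy]
  have hpcomp : Δ.IsComparisonPoint ![u, v, w] 2 p w := by
    refine ⟨hS₂.left_mem, left_mem_segment ℝ _ _, ?_, ?_⟩
    · change dist w w = dist p p
      rw [dist_self, dist_self]
    · exact hwu
  have hconv : dist z' w ≤ (1 - t) * dist u w + t * dist v w := by
    have := (convexOn_dist w (convex_univ (𝕜 := ℝ) (E := EuclideanSpace ℝ (Fin 2)))).2
      (Set.mem_univ u) (Set.mem_univ v) (sub_nonneg.2 ht1) ht0 (by ring)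
    rw [hz', AffineMap.lineMap_apply_module]
    simpa using this
  calc dist z p ≤ dist z' w := hX.2 Δ _ hcomp 0 2 z p z' w hzcomp hpcomp
    _ ≤ _ := hconv
    _ = _ := by rw [dist_comm u w, hwu, hvw, dist_comm p x]

/-! ### A lazy symmetric random walk -/

/-- Expectation of `sign (k + S)`, where `S` is the position at time `m` of a random walk whose
`i`-th step is `1` or `-1` with probability `lam i * (1 - lam i)` each and `0` otherwise. -/
def walkSign (lam : ℕ → ℝ) : ℕ → ℤ → ℝ
  | 0, k => (Int.sign k : ℤ)
  | m + 1, k =>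
    lam (m + 1) * (1 - lam (m + 1)) * (walkSign lam m (k + 1) + walkSign lam m (k - 1)) +
      (1 - 2 * (lam (m + 1) * (1 - lam (m + 1)))) * walkSign lam m k

theorem walkSign_neg (lam : ℕ → ℝ) (m : ℕ) (k : ℤ) :
    walkSign lam m (-k) = -walkSign lam m k := by
  induction m generalizing k with
  | zero => simp [walkSign]
  | succ m ih =>
    have h₁ : -k + 1 = -(k - 1) := by ring
    have h₂ : -k - 1 = -(k + 1) := by ring
    rw [walkSign, walkSign, h₁, h₂, ih, ih, ih]
    ring

/-- Symmetry of the walk; this matches the boundary value `d(x m, x m) = 0`. -/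
theorem walkSign_at_zero (lam : ℕ → ℝ) (m : ℕ) : walkSign lam m 0 = 0 := by
  have := walkSign_neg lam m 0
  rw [neg_zero] at this
  linarith

/-- Expectation of `walkSign lam m (k + N)`, where `N` is the number of successes among independent
Bernoulli trials with parameters `lam (m + 1), …, lam (m + d)`. -/
def leadExpectation (lam : ℕ → ℝ) (m : ℕ) : ℕ → ℤ → ℝ
  | 0, k => walkSign lam m k
  | d + 1, k => (1 - lam (m + d + 1)) * leadExpectation lam m d k +
      lam (m + d + 1) * leadExpectation lam m d (k + 1)

/-- Step `m + 1` of the walk is a difference of two independent Bernoulli variables: the positive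
one joins the trials of `N`, and one conditions on the other. -/
theorem leadExpectation_succ_left (lam : ℕ → ℝ) (m d : ℕ) (k : ℤ) :
    leadExpectation lam (m + 1) d k = (1 - lam (m + 1)) * leadExpectation lam m (d + 1) k +
      lam (m + 1) * leadExpectation lam m (d + 1) (k - 1) := by
  induction d generalizing k with
  | zero => simp only [leadExpectation, walkSign, sub_add_cancel, add_zero]; ring
  | succ d ih =>
    have hrec : ∀ j, leadExpectation lam m (d + 1 + 1) j =
        (1 - lam (m + (d + 1) + 1)) * leadExpectation lam m (d + 1) j +
          lam (m + (d + 1) + 1) * leadExpectation lam m (d + 1) (j + 1) := fun _ => rfl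
    rw [leadExpectation, ih, ih, hrec, hrec, sub_add_cancel, add_sub_cancel_right,
      show m + 1 + d + 1 = m + (d + 1) + 1 by ring]
    ring

theorem leadExpectation_zero_left (lam : ℕ → ℝ) (d : ℕ) {k : ℤ} (hk : 1 ≤ k) :
    leadExpectation lam 0 d k = 1 := by
  induction d generalizing k with
  | zero => simp [leadExpectation, walkSign, Int.sign_eq_one_of_pos (by omega : 0 < k)]
  | succ d ih =>
    rw [leadExpectation, ih hk, ih (by omega)]
    ring

/-- Solution of the recursive inequalities satisfied by `a m n = d(x m, x n)` and
`b m n = d(x m, T (x n))`. -/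
theorem le_leadExpectation {lam : ℕ → ℝ} (hlam : ∀ n, lam (n + 1) ∈ Set.Icc (0 : ℝ) 1) {D : ℝ}
    {a b : ℕ → ℕ → ℝ} (ha₀ : ∀ m, a m m ≤ 0) (hb₀ : ∀ n, b 0 n ≤ D)
    (ha : ∀ m n, a m (n + 1) ≤ (1 - lam (n + 1)) * a m n + lam (n + 1) * b m n)
    (hb : ∀ m n, b (m + 1) (n + 1) ≤ (1 - lam (m + 1)) * b m (n + 1) + lam (m + 1) * a m (n + 1))
    (m d : ℕ) :
    a m (m + d) ≤ D * leadExpectation lam m d 0 ∧ b m (m + d) ≤ D * leadExpectation lam m d 1 := by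
  -- Row `m` of `b` controls row `m` of `a`; the two together control row `m + 1` of `b`.
  have key : ∀ m, (∀ d, b m (m + d) ≤ D * leadExpectation lam m d 1) →
      ∀ d, a m (m + d) ≤ D * leadExpectation lam m d 0 := by
    intro m hm d
    induction d with
    | zero => simpa [leadExpectation, walkSign_at_zero] using ha₀ m
    | succ d ih =>
      obtain ⟨h0, h1⟩ := hlam (m + d)
      calc a m (m + d + 1) ≤ _ := ha m (m + d)
        _ ≤ (1 - lam (m + d + 1)) * (D * leadExpectation lam m d 0) +
            lam (m + d + 1) * (D * leadExpectation lam m d 1) :=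
          add_le_add (mul_le_mul_of_nonneg_left ih (sub_nonneg.2 h1))
            (mul_le_mul_of_nonneg_left (hm d) h0)
        _ = _ := by rw [leadExpectation, zero_add]; ring
  have hbm : ∀ m d, b m (m + d) ≤ D * leadExpectation lam m d 1 := by
    intro m
    induction m with
    | zero => intro d; rw [leadExpectation_zero_left lam d le_rfl, mul_one]; exact hb₀ _
    | succ m ih =>
      intro d
      obtain ⟨h0, h1⟩ := hlam m
      rw [leadExpectation_succ_left, sub_self, show m + 1 + d = m + d + 1 by ring]
      calc _ ≤ _ := hb m (m + d)
        _ ≤ (1 - lam (m + 1)) * (D * leadExpectation lam m (d + 1) 1) +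
            lam (m + 1) * (D * leadExpectation lam m (d + 1) 0) :=
          add_le_add (mul_le_mul_of_nonneg_left (ih (d + 1)) (sub_nonneg.2 h1))
            (mul_le_mul_of_nonneg_left (key m ih (d + 1)) h0)
        _ = _ := by ring
  exact ⟨key m (hbm m) d, hbm m d⟩

/-! ### Fourier representation and the Gaussian bound -/

theorem integral_cos_int_mul (k : ℤ) :
    ∫ θ in (0 : ℝ)..Real.pi, Real.cos (k * θ) = if k = 0 then Real.pi else 0 := by
  split_ifs with hk
  · simp [hk]
  · rw [intervalIntegral.integral_comp_mul_left (fun x => Real.cos x) (by exact_mod_cast hk)]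
    simp [Real.sin_int_mul_pi]

/-- The difference is `P(S = -k) + P(S = 1 - k)`, and the product is the characteristic function of
`S`. -/
theorem walkSign_sub_eq_integral (lam : ℕ → ℝ) (m : ℕ) (k : ℤ) :
    Real.pi * (walkSign lam m k - walkSign lam m (k - 1)) =
      ∫ θ in (0 : ℝ)..Real.pi,
        (∏ i ∈ Finset.Icc 1 m, (1 - 2 * (lam i * (1 - lam i)) * (1 - Real.cos θ))) *
          (Real.cos (k * θ) + Real.cos ((k - 1 : ℤ) * θ)) := by
  induction m generalizing k with
  | zero =>
    simp only [Finset.Icc_eq_empty_of_lt zero_lt_one, Finset.prod_empty, one_mul]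
    rw [intervalIntegral.integral_add (Continuous.intervalIntegrable (by fun_prop) _ _)
      (Continuous.intervalIntegrable (by fun_prop) _ _), integral_cos_int_mul,
      integral_cos_int_mul]
    simp only [walkSign]
    -- The sign jumps by one at `k = 0` and at `k = 1`, and nowhere else.
    rcases lt_trichotomy k 0 with h | rfl | h
    · rw [if_neg (by omega), if_neg (by omega), Int.sign_eq_neg_one_of_neg h,
        Int.sign_eq_neg_one_of_neg (by omega)]
      simp
    · simp
    · rcases eq_or_ne k 1 with rfl | h'
      · simp
      · rw [if_neg (by omega), if_neg (by omega), Int.sign_eq_one_of_pos h,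
          Int.sign_eq_one_of_pos (by omega)]
        simp
  | succ m ih =>
    set p := lam (m + 1) * (1 - lam (m + 1)) with hp
    have hcos : ∀ (j : ℤ) (θ : ℝ), Real.cos ((j + 1 : ℤ) * θ) + Real.cos ((j - 1 : ℤ) * θ) =
        2 * Real.cos θ * Real.cos (j * θ) := by
      intro j θ
      push_cast
      rw [add_mul, sub_mul, one_mul, Real.cos_add, Real.cos_sub]
      ring
    have hcont : ∀ j : ℤ, IntervalIntegrable (fun θ : ℝ =>
        (∏ i ∈ Finset.Icc 1 m, (1 - 2 * (lam i * (1 - lam i)) * (1 - Real.cos θ))) *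
          (Real.cos (j * θ) + Real.cos ((j - 1 : ℤ) * θ))) MeasureTheory.volume 0 Real.pi :=
      fun j => Continuous.intervalIntegrable (by fun_prop) _ _
    have hstep : Real.pi * (walkSign lam (m + 1) k - walkSign lam (m + 1) (k - 1)) =
        p * (Real.pi * (walkSign lam m (k + 1) - walkSign lam m (k + 1 - 1)) +
          Real.pi * (walkSign lam m (k - 1) - walkSign lam m (k - 1 - 1))) +
        (1 - 2 * p) * (Real.pi * (walkSign lam m k - walkSign lam m (k - 1))) := by
      simp only [walkSign, ← hp, sub_add_cancel, add_sub_cancel_right]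
      ring
    rw [hstep, ih, ih, ih, ← intervalIntegral.integral_add (hcont _) (hcont _),
      ← intervalIntegral.integral_const_mul, ← intervalIntegral.integral_const_mul,
      ← intervalIntegral.integral_add (((hcont _).add (hcont _)).const_mul p)
        ((hcont _).const_mul _)]
    refine intervalIntegral.integral_congr fun θ _ => ?_
    rw [Finset.prod_Icc_succ_top (by omega), ← hp]
    have h₁ := hcos k θ
    have h₂ := hcos (k - 1) θ
    rw [sub_add_cancel] at h₂
    rw [add_sub_cancel_right]
    linear_combination (p * ∏ i ∈ Finset.Icc 1 m,
      (1 - 2 * (lam i * (1 - lam i)) * (1 - Real.cos θ))) * (h₁ + h₂)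

theorem integral_exp_neg_mul_sq_le {c : ℝ} (hc : 0 < c) :
    ∫ u in (0 : ℝ)..1, Real.exp (-c * u ^ 2) ≤ √(Real.pi / c) / 2 := by
  rw [← integral_gaussian_Ioi, intervalIntegral.integral_of_le zero_le_one]
  exact MeasureTheory.setIntegral_mono_set (integrable_exp_neg_mul_sq hc).integrableOn
    (Filter.Eventually.of_forall fun u => (Real.exp_pos _).le)
    (Filter.Eventually.of_forall fun u hu => hu.1)

/-- Half angles turn `1 + cos θ` into `2 cos² (θ / 2) ≤ 2 cos (θ / 2)`, which is `4 du/dθ` for `u =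
sin (θ / 2)`; a Gaussian integral remains. -/
theorem integral_exp_cos_le {s : ℝ} (hs : 0 < s) :
    ∫ θ in (0 : ℝ)..Real.pi, Real.exp (-(2 * s * (1 - Real.cos θ))) * (1 + Real.cos θ) ≤
      √(Real.pi / s) := by
  have hsub : ∫ θ in (0 : ℝ)..Real.pi,
      ((fun u => Real.exp (-(4 * s) * u ^ 2)) ∘ fun θ => Real.sin (θ / 2)) θ *
        (Real.cos (θ / 2) * (1 / 2)) = ∫ u in (0 : ℝ)..1, Real.exp (-(4 * s) * u ^ 2) := by
    have hderiv : ∀ θ ∈ Set.uIcc 0 Real.pi,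
        HasDerivAt (fun θ => Real.sin (θ / 2)) (Real.cos (θ / 2) * (1 / 2)) θ :=
      fun θ _ => ((hasDerivAt_id θ).div_const 2).sin
    rw [intervalIntegral.integral_comp_mul_deriv hderiv (by fun_prop) (by fun_prop)]
    simp
  have hle : ∫ θ in (0 : ℝ)..Real.pi, Real.exp (-(2 * s * (1 - Real.cos θ))) * (1 + Real.cos θ) ≤
      ∫ θ in (0 : ℝ)..Real.pi, 4 *
        (((fun u => Real.exp (-(4 * s) * u ^ 2)) ∘ fun θ => Real.sin (θ / 2)) θ *
          (Real.cos (θ / 2) * (1 / 2))) := by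
    refine intervalIntegral.integral_mono_on Real.pi_pos.le
      (Continuous.intervalIntegrable (by fun_prop) _ _)
      (Continuous.intervalIntegrable (by simp only [Function.comp_def]; fun_prop) _ _) ?_
    rintro θ ⟨h0, h1⟩
    have hcos : Real.cos θ = 2 * Real.cos (θ / 2) ^ 2 - 1 := by
      rw [← Real.cos_two_mul, mul_div_cancel₀ θ two_ne_zero]
    have hexp : -(2 * s * (1 - Real.cos θ)) = -(4 * s) * Real.sin (θ / 2) ^ 2 := by
      rw [hcos, Real.sin_sq]; ring
    have hc0 : 0 ≤ Real.cos (θ / 2) := Real.cos_nonneg_of_mem_Icc ⟨by linarith, by linarith⟩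
    have hc1 := Real.cos_le_one (θ / 2)
    rw [hexp, hcos]
    simp only [Function.comp_apply]
    have := Real.exp_pos (-(4 * s) * Real.sin (θ / 2) ^ 2)
    nlinarith [mul_nonneg this.le (mul_nonneg hc0 (sub_nonneg.2 hc1))]
  rw [intervalIntegral.integral_const_mul, hsub] at hle
  have hroot : √(Real.pi / (4 * s)) = √(Real.pi / s) / 2 := by
    rw [show Real.pi / (4 * s) = Real.pi / s / 2 ^ 2 by field_simp; norm_num,
      Real.sqrt_div (by positivity), Real.sqrt_sq zero_le_two]
  linarith [integral_exp_neg_mul_sq_le (mul_pos four_pos hs)]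

theorem walkSign_one_le {lam : ℕ → ℝ} {n : ℕ}
    (hpos : 0 < ∑ i ∈ Finset.Icc 1 n, lam i * (1 - lam i)) :
    walkSign lam n 1 ≤ 1 / √(Real.pi * ∑ i ∈ Finset.Icc 1 n, lam i * (1 - lam i)) := by
  set s := ∑ i ∈ Finset.Icc 1 n, lam i * (1 - lam i) with hs
  have hint := walkSign_sub_eq_integral lam n 1
  rw [sub_self, walkSign_at_zero, sub_zero] at hint
  have hle : Real.pi * walkSign lam n 1 ≤ √(Real.pi / s) := by
    rw [hint]
    refine le_trans (intervalIntegral.integral_mono_on Real.pi_pos.le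
      (Continuous.intervalIntegrable (by fun_prop) _ _)
      (Continuous.intervalIntegrable (by fun_prop) _ _) fun θ _ => ?_) (integral_exp_cos_le hpos)
    have hc1 := Real.cos_le_one θ
    have hc2 := Real.neg_one_le_cos θ
    have hprod : ∏ i ∈ Finset.Icc 1 n, (1 - 2 * (lam i * (1 - lam i)) * (1 - Real.cos θ)) ≤
        Real.exp (-(2 * s * (1 - Real.cos θ))) := by
      rw [show -(2 * s * (1 - Real.cos θ)) =
          ∑ i ∈ Finset.Icc 1 n, -(2 * (lam i * (1 - lam i)) * (1 - Real.cos θ)) by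
        rw [Finset.sum_neg_distrib, ← Finset.sum_mul, ← Finset.mul_sum], Real.exp_sum]
      refine Finset.prod_le_prod (fun i _ => ?_) fun i _ => Real.one_sub_le_exp_neg _
      -- Factors are nonnegative since `lam i * (1 - lam i) ≤ 1 / 4` and `1 - cos θ ≤ 2`.
      nlinarith [sq_nonneg (lam i - 1 / 2), mul_nonneg (sq_nonneg (lam i - 1 / 2))
        (sub_nonneg.2 hc1)]
    have : (Real.cos (((1 : ℤ) : ℝ) * θ) + Real.cos (((0 : ℤ) : ℝ) * θ)) = 1 + Real.cos θ := by
      simp [add_comm]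
    rw [this]
    exact mul_le_mul_of_nonneg_right hprod (by linarith)
  have hroot : √(Real.pi / s) = Real.pi * (1 / √(Real.pi * s)) := by
    rw [Real.sqrt_div Real.pi_pos.le, Real.sqrt_mul Real.pi_pos.le]
    have h1 := Real.mul_self_sqrt Real.pi_pos.le
    have h2 : 0 < √Real.pi := Real.sqrt_pos.2 Real.pi_pos
    have h3 : 0 < √s := Real.sqrt_pos.2 hpos
    field_simp
    linarith
  rw [hroot] at hle
  exact le_of_mul_le_mul_left hle Real.pi_pos

/-! ### Krasnosel'skii–Mann iterates -/

theorem IsKMIteration.mem {X : Type*} [MetricSpace X] {K : Set X} (hK : IsGeodesicallyConvex K)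
    {T : X → X} (hTK : Set.MapsTo T K K) {lam : ℕ → ℝ} {x : ℕ → X}
    (hx : IsKMIteration K T lam x) (n : ℕ) : x n ∈ K := by
  induction n with
  | zero => exact hx.1
  | succ n ih =>
    obtain ⟨⟨S, hS, hmem⟩, -⟩ := hx.2 n
    exact hK _ ih _ (hTK ih) S hS hmem

theorem mainTheorem1 {X : Type*} [MetricSpace X] [CompleteSpace X] (hX : IsCAT0Space X)
    (K : Set X) (hKne : K.Nonempty) (hKclosed : IsClosed K) (hKconv : IsGeodesicallyConvex K)
    (hKbdd : Bornology.IsBounded K)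
    (T : X → X) (hTK : Set.MapsTo T K K)
    (hT : ∀ x ∈ K, ∀ y ∈ K, dist (T x) (T y) ≤ dist x y)
    (lam : ℕ → ℝ) (hlam : ∀ n : ℕ, 1 ≤ n → lam n ∈ Set.Ioo (0 : ℝ) 1)
    (x : ℕ → X) (hx : IsKMIteration K T lam x) (n : ℕ) (hn : 1 ≤ n) :
    dist (x n) (T (x n)) ≤
      Metric.diam K / Real.sqrt (Real.pi * ∑ i ∈ Finset.Icc 1 n, lam i * (1 - lam i)) := by
  have hmem := hx.mem hKconv hTK
  have hlam' : ∀ n, lam (n + 1) ∈ Set.Icc (0 : ℝ) 1 := fun n =>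
    Set.Ioo_subset_Icc_self (hlam (n + 1) (by omega))
  have hpos : 0 < ∑ i ∈ Finset.Icc 1 n, lam i * (1 - lam i) :=
    Finset.sum_pos (fun i hi => by
      obtain ⟨h0, h1⟩ := hlam i (Finset.mem_Icc.1 hi).1
      exact mul_pos h0 (sub_pos.2 h1)) ⟨1, Finset.mem_Icc.2 ⟨le_rfl, hn⟩⟩
  have hbound := (le_leadExpectation hlam' (D := Metric.diam K)
    (a := fun m n => dist (x m) (x n)) (b := fun m n => dist (x m) (T (x n)))
    (fun m => (dist_self _).le)
    (fun n => Metric.dist_le_diam_of_mem hKbdd (hmem 0) (hTK (hmem n)))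
    (fun m n => by
      have := hX.dist_geodesicCombination_le (hlam' n) (hx.2 n) (x m)
      simpa only [dist_comm] using this)
    (fun m n => by
      refine (hX.dist_geodesicCombination_le (hlam' m) (hx.2 m) _).trans ?_
      have := mul_le_mul_of_nonneg_left (hT _ (hmem m) _ (hmem (n + 1))) (hlam' m).1
      simpa using this) n 0).2
  calc dist (x n) (T (x n)) ≤ Metric.diam K * walkSign lam n 1 := hbound
    _ ≤ Metric.diam K * (1 / √(Real.pi * ∑ i ∈ Finset.Icc 1 n, lam i * (1 - lam i))) :=
      mul_le_mul_of_nonneg_left (walkSign_one_le hpos) Metric.diam_nonneg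
    _ = _ := mul_one_div _ _
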